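/- Let $(X,S)$ be a measurable space in which every one-point set is measurable. A measurable field of Hilbert spaces $\mathcal H$ on $(X,S)$ is a family $(\mathcal H_x)_{x\in X}$ of complex Hilbert spaces with a linear subspace $\mathcal M_{\mathcal H}\subset\prod_{x}\mathcal H_x$ (the measurable sections) such that (1) $x\mapsto\|\xi(x)\|$ is measurable for every $\xi\in\mathcal M_{\mathcal H}$; (2) every $\eta\in\prod_x\mathcal H_x$ for which $x\mapsto\langle\eta(x)\,|\,\xi(x)\rangle$ is measurable for all $\xi\in\mathcal M_{\mathcal H}$ lies in $\mathcal M_{\mathcal H}$; (3) there is a sequence $(\xi_i)$ in $\mathcal M_{\mathcal H}$ such that $\{\xi_i(x)\}_i$ is dense in $\mathcal H_x$ for every $x$. Let $\mathbf{Meas}(X,S)$ be the category whose objects are the measurable fields of Hilbert spaces on $(X,S)$ and whose arrows $\phi:\mathcal H\to\mathcal K$ are the families of bounded operators $\phi_x:\mathcal H_x\to\mathcal K_x$ that carry measurable sections to measurable sections and satisfy $\|\phi\|=\sup_x\|\phi_x\|<\infty$; it is $\mathbb C$-linear with fiberwise operations. A functor $F$ between such categories is bounded if there is $N>0$ with $\|F(\phi)\|\le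 N\|\phi\|$ for all arrows $\phi$. For a measurable function $f:(Y,T)\to(X,S)$ the pullback functor $f^*:\mathbf{Meas}(X,S)\to\mathbf{Meas}(Y,T)$ is given by $(f^*\mathcal H)_y=\mathcal H_{f(y)}$ and $(f^*\phi)_y=\phi_{f(y)}$, where $\mathcal M_{f^*\mathcal H}$ consists of all $\eta\in\prod_y\mathcal H_{f(y)}$ such that $y\mapsto\langle\xi(f(y))\,|\,\eta(y)\rangle$ is measurable for all $\xi\in\mathcal M_{\mathcal H}$. **Theorem.** Let $(X,S)$ and $(Y,T)$ be measurable spaces in which every one-point set is measurable, let $F:\mathbf{Meas}(X,S)\to\mathbf{Meas}(Y,T)$ be a $\mathbb C$-linear (hence additive) functor that is invertible, with inverse $G$ (that is, $GF\cong\mathrm{Id}$ and $FG\cong\mathrm{Id}$ naturally), and suppose that $F$ and $G$ are bounded. Then there is a bijection $f:Y\to X$, measurable with measurable inverse, such that $F$ is naturally isomorphic to $f^*$ and $G$ is naturally isomorphic to $(f^{-1})^*$. -/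

import Mathlib

open CategoryTheory

universe u v w

noncomputable section

/-- A measurable field of (complex) Hilbert spaces on a measurable space `X`: a family of Hilbert
spaces indexed by the points of `X`, with a linear space of sections, called measurable. -/
structure MeasField (X : Type u) [MeasurableSpace X] where
  /-- the Hilbert space at a point -/
  fiber : X → Type w
  [normedAddCommGroup : ∀ x, NormedAddCommGroup (fiber x)]
  [innerProductSpace : ∀ x, InnerProductSpace ℂ (fiber x)]
  [completeSpace : ∀ x, CompleteSpace (fiber x)]
  /-- the measurable sections -/
  sections : Submodule ℂ (∀ x, fiber x)
  measurable_norm : ∀ ξ ∈ sections, Measurable fun x => ‖ξ x‖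
  mem_of_measurable_inner : ∀ η : ∀ x, fiber x,
    (∀ ξ ∈ sections, Measurable fun x => inner ℂ (η x) (ξ x)) → η ∈ sections
  exists_fundamental_sequence : ∃ ξ : ℕ → ∀ x, fiber x,
    (∀ i, ξ i ∈ sections) ∧ ∀ x, Dense (Set.range fun i => ξ i x)

attribute [instance] MeasField.normedAddCommGroup MeasField.innerProductSpace
  MeasField.completeSpace

namespace MeasField

section Arrows

variable {X : Type u} [MeasurableSpace X]

/-- The bounded measurable fields of bounded operators from `H` to `K`: families of bounded
operators with bounded operator norms which carry measurable sections to measurable sections. -/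
def boundedFields (H K : MeasField.{u, w} X) :
    Submodule ℂ (∀ x, H.fiber x →L[ℂ] K.fiber x) where
  carrier := {φ | BddAbove (Set.range fun x => ‖φ x‖) ∧
    ∀ ξ ∈ H.sections, (fun x => φ x (ξ x)) ∈ K.sections}
  zero_mem' := by
    refine ⟨⟨0, ?_⟩, fun ξ _ => ?_⟩
    · rintro _ ⟨x, rfl⟩
      simp
    · exact K.sections.zero_mem
  add_mem' := by
    rintro φ ψ ⟨⟨a, ha⟩, hφ⟩ ⟨⟨b, hb⟩, hψ⟩
    refine ⟨⟨a + b, ?_⟩, fun ξ hξ => ?_⟩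
    · rintro _ ⟨x, rfl⟩
      exact (norm_add_le _ _).trans (add_le_add (ha ⟨x, rfl⟩) (hb ⟨x, rfl⟩))
    · exact K.sections.add_mem (hφ ξ hξ) (hψ ξ hξ)
  smul_mem' := by
    rintro c φ ⟨⟨a, ha⟩, hφ⟩
    refine ⟨⟨‖c‖ * a, ?_⟩, fun ξ hξ => ?_⟩
    · rintro _ ⟨x, rfl⟩
      exact (norm_smul_le _ _).trans
        (mul_le_mul_of_nonneg_left (ha ⟨x, rfl⟩) (norm_nonneg c))
    · exact K.sections.smul_mem c (hφ ξ hξ)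

/-- The category of measurable fields of Hilbert spaces on `X`, whose arrows are the bounded
measurable fields of operators. -/
instance category : Category (MeasField.{u, w} X) where
  Hom H K := boundedFields H K
  id H := ⟨fun x => ContinuousLinearMap.id ℂ (H.fiber x),
    ⟨1, by rintro _ ⟨x, rfl⟩; exact ContinuousLinearMap.norm_id_le⟩, fun _ hξ => hξ⟩
  comp {H K L} φ ψ := ⟨fun x => (ψ.1 x).comp (φ.1 x), by
    obtain ⟨φ, ⟨a, ha⟩, hφ⟩ := φ
    obtain ⟨ψ, ⟨b, hb⟩, hψ⟩ := ψ
    refine ⟨⟨b * a, ?_⟩, fun ξ hξ => hψ _ (hφ ξ hξ)⟩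
    rintro _ ⟨x, rfl⟩
    have h1 : ‖φ x‖ ≤ a := ha ⟨x, rfl⟩
    have h2 : ‖ψ x‖ ≤ b := hb ⟨x, rfl⟩
    exact (ContinuousLinearMap.opNorm_comp_le _ _).trans
      (mul_le_mul h2 h1 (norm_nonneg _) ((norm_nonneg _).trans h2))⟩

/-- The operator at the point `x` of a field of operators. -/
def app {H K : MeasField.{u, w} X} (φ : H ⟶ K) (x : X) : H.fiber x →L[ℂ] K.fiber x :=
  φ.1 x

theorem hom_ext {H K : MeasField.{u, w} X} {φ ψ : H ⟶ K} (h : ∀ x, app φ x = app ψ x) :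
    φ = ψ :=
  Subtype.ext (funext h)

/-- Addition of arrows is fiberwise. -/
instance preadditive : Preadditive (MeasField.{u, w} X) where
  homGroup H K := inferInstanceAs (AddCommGroup (boundedFields H K))
  add_comp _ _ _ φ φ' ψ := hom_ext fun x => ContinuousLinearMap.comp_add (ψ.1 x) (φ.1 x) (φ'.1 x)
  comp_add _ _ _ φ ψ ψ' := hom_ext fun x => ContinuousLinearMap.add_comp (ψ.1 x) (ψ'.1 x) (φ.1 x)

/-- Multiplication of arrows by complex scalars is fiberwise. -/
instance linear : Linear ℂ (MeasField.{u, w} X) where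
  homModule H K := inferInstanceAs (Module ℂ (boundedFields H K))
  smul_comp _ _ _ c φ ψ := hom_ext fun x => ContinuousLinearMap.comp_smul (ψ.1 x) c (φ.1 x)
  comp_smul _ _ _ φ c ψ := hom_ext fun x => ContinuousLinearMap.smul_comp c (ψ.1 x) (φ.1 x)

/-- The norm of an arrow is the supremum of the operator norms in the fibers. -/
instance homNorm (H K : MeasField.{u, w} X) : Norm (H ⟶ K) :=
  ⟨fun φ => ⨆ x, ‖app φ x‖⟩

theorem measurable_inner (H : MeasField.{u, w} X) {ξ η : ∀ x, H.fiber x}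
    (hξ : ξ ∈ H.sections) (hη : η ∈ H.sections) :
    Measurable fun x => inner ℂ (ξ x) (η x) := by
  have h (c : ℂ) : Measurable fun x => ((‖ξ x + c • η x‖ : ℝ) : ℂ) :=
    Complex.measurable_ofReal.comp
      (H.measurable_norm _ (H.sections.add_mem hξ (H.sections.smul_mem c hη)))
  have e : (fun x => inner ℂ (ξ x) (η x)) = fun x =>
      (((‖ξ x + (1 : ℂ) • η x‖ : ℝ) : ℂ) ^ 2 - ((‖ξ x + (-1 : ℂ) • η x‖ : ℝ) : ℂ) ^ 2
        + (((‖ξ x + (-Complex.I) • η x‖ : ℝ) : ℂ) ^ 2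
        - ((‖ξ x + Complex.I • η x‖ : ℝ) : ℂ) ^ 2) * Complex.I) / 4 := by
    funext x
    rw [inner_eq_sum_norm_sq_div_four (𝕜 := ℂ) (ξ x) (η x)]
    simp [sub_eq_add_neg]
  rw [e]
  exact (((h 1).pow_const 2 |>.sub ((h (-1)).pow_const 2)).add
    (((h (-Complex.I)).pow_const 2 |>.sub ((h Complex.I).pow_const 2)).mul_const _)).div_const _

/-- The fiberwise adjoint of a field of operators preserves measurable sections. -/
theorem adjoint_mem {H K : MeasField.{u, w} X} (φ : H ⟶ K) {ξ : ∀ x, K.fiber x}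
    (hξ : ξ ∈ K.sections) :
    (fun x => ContinuousLinearMap.adjoint (app φ x) (ξ x)) ∈ H.sections := by
  refine H.mem_of_measurable_inner _ fun ζ hζ => ?_
  simp only [ContinuousLinearMap.adjoint_inner_left]
  exact K.measurable_inner hξ (φ.2.2 ζ hζ)

end Arrows

/-- In a Hilbert space, the norm is computed from the inner products with a dense sequence. -/
theorem enorm_eq_iSup {E : Type*} [NormedAddCommGroup E] [InnerProductSpace ℂ E]
    {e : ℕ → E} (he : Dense (Set.range e)) (v : E) :
    (‖v‖ₑ : ENNReal) = ⨆ i, ‖inner ℂ (e i) v‖ₑ / ‖e i‖ₑ := by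
  apply le_antisymm
  · refine le_of_forall_lt fun c hc => ?_
    lift c to NNReal using hc.ne_top
    have hc' : (c : ℝ) < ‖v‖ := by
      have := ENNReal.toReal_strict_mono enorm_ne_top hc
      simpa using this
    have hv : 0 < ‖v‖ := c.2.trans_lt hc'
    have ho : IsOpen {u : E | (c : ℝ) * ‖u‖ < ‖inner ℂ u v‖} :=
      isOpen_lt (by fun_prop) (by fun_prop)
    have hm : v ∈ {u : E | (c : ℝ) * ‖u‖ < ‖inner ℂ u v‖} := by
      have h1 : ‖inner ℂ v v‖ = ‖v‖ * ‖v‖ := by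
        rw [inner_self_eq_norm_sq_to_K]
        simp [sq]
      simp only [Set.mem_ofPred_eq, h1]
      exact mul_lt_mul_of_pos_right hc' hv
    obtain ⟨_, ⟨i, rfl⟩, hu⟩ := he.exists_mem_open ho ⟨v, hm⟩
    refine lt_of_lt_of_le ?_ (le_iSup (fun i => ‖inner ℂ (e i) v‖ₑ / ‖e i‖ₑ) i)
    have hi : e i ≠ 0 := by
      intro h
      simp [h] at hu
    rw [ENNReal.lt_div_iff_mul_lt (Or.inl (by simpa using hi)) (Or.inl enorm_ne_top)]
    have h2 : c * ‖e i‖₊ < ‖inner ℂ (e i) v‖₊ := by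
      rw [← NNReal.coe_lt_coe]
      exact hu
    simp only [enorm_eq_nnnorm]
    exact_mod_cast h2
  · refine iSup_le fun i => ENNReal.div_le_of_le_mul ?_
    have h := nnnorm_inner_le_nnnorm (𝕜 := ℂ) (e i) v
    rw [mul_comm] at h
    simp only [enorm_eq_nnnorm]
    exact_mod_cast h

section Pullback

variable {X : Type u} {Y : Type v} [MeasurableSpace X] [MeasurableSpace Y]

/-- The pullback of a measurable field along a measurable function `f`: the fiber at `y` is the
fiber at `f y`, and the measurable sections are generated by the sections `y ↦ ξ (f y)` with `ξ`
measurable (that is, they are all sections whose inner products with these are measurable). -/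
def pullbackObj (f : Y → X) (hf : Measurable f) (H : MeasField.{u, w} X) :
    MeasField.{v, w} Y where
  fiber y := H.fiber (f y)
  sections :=
    { carrier := {η | ∀ ξ ∈ H.sections, Measurable fun y => inner ℂ (ξ (f y)) (η y)}
      zero_mem' := fun ξ _ => by simp
      add_mem' := fun {a b} ha hb ξ hξ => by
        simp only [Pi.add_apply, inner_add_right]
        exact (ha ξ hξ).add (hb ξ hξ)
      smul_mem' := fun c a ha ξ hξ => by
        simp only [Pi.smul_apply, inner_smul_right]
        exact (ha ξ hξ).const_mul c }
  measurable_norm η hη := by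
    obtain ⟨e, he, hd⟩ := H.exists_fundamental_sequence
    have h : Measurable fun y => ‖η y‖ₑ := by
      simp only [fun y => enorm_eq_iSup (hd (f y)) (η y)]
      refine Measurable.iSup fun i => Measurable.div (hη (e i) (he i)).enorm ?_
      simp only [← ofReal_norm]
      exact ((H.measurable_norm _ (he i)).comp hf).ennreal_ofReal
    simpa only [toReal_enorm] using h.ennreal_toReal
  mem_of_measurable_inner η h := by
    intro ξ hξ
    have h' := h (fun y => ξ (f y)) fun ζ hζ => (H.measurable_inner hζ hξ).comp hf
    have h'' := Complex.continuous_conj.measurable.comp h'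
    simpa only [Function.comp_def, inner_conj_symm] using h''
  exists_fundamental_sequence := by
    obtain ⟨e, he, hd⟩ := H.exists_fundamental_sequence
    exact ⟨fun i y => e i (f y), fun i ζ hζ => (H.measurable_inner hζ (he i)).comp hf,
      fun y => hd (f y)⟩

/-- The pullback functor along a measurable function `f`; a field of operators `φ` is carried to
the field with the operator `φ (f y)` at `y`. -/
def pullback (f : Y → X) (hf : Measurable f) : MeasField.{u, w} X ⥤ MeasField.{v, w} Y where
  obj H := pullbackObj f hf H
  map {H K} φ := ⟨fun y => app φ (f y), by
    refine ⟨φ.2.1.mono ?_, fun η hη ξ hξ => ?_⟩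
    · rintro _ ⟨y, rfl⟩
      exact ⟨f y, rfl⟩
    · have h := hη _ (adjoint_mem φ hξ)
      have e : (fun y => inner ℂ (ξ (f y)) (app φ (f y) (η y))) = fun y =>
          inner ℂ (ContinuousLinearMap.adjoint (app φ (f y)) (ξ (f y))) (η y) :=
        funext fun y => (ContinuousLinearMap.adjoint_inner_left (app φ (f y)) (η y) (ξ (f y))).symm
      exact e ▸ h⟩

/-- A functor is bounded if it multiplies the norms of arrows at most by a constant. -/
def IsBounded (F : MeasField.{u, w} X ⥤ MeasField.{v, w} Y) : Prop :=
  ∃ N : ℝ, 0 < N ∧ ∀ (H K : MeasField.{u, w} X) (φ : H ⟶ K), ‖F.map φ‖ ≤ N * ‖φ‖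

end Pullback

end MeasField

end

/-! Let `L` be the trivial line field. Its endomorphisms are the bounded measurable functions, so
its idempotents are the measurable sets, composed by intersection. Arrows `L ⟶ H` are the bounded
measurable sections of `H`; those supported at `x` are the vectors of `H.fiber x`, with the same
norm.

An equivalence `F` carries `L` to a line field: commuting endomorphisms force fibers of dimension at
most one (`exists_smul_eq_of_end_comm`), and a separator has no zero fiber. So `F` matches the
measurable sets of `X` with those of `Y`, respecting intersection and emptiness. One-point sets then
correspond to one-point sets, which defines `f` (`exists_measurableEquiv`).

Applying `F` to arrows supported at `f y` gives maps from `H.fiber (f y)` to `(F.obj H).fiber y`,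
natural in `H`. Boundedness of `F` bounds them uniformly in `y`, boundedness of `G` bounds them
below, and fullness lifts bounded sections, so they form an isomorphism (`nonempty_iso_pullback`).
The claim about `G` is then formal. -/

noncomputable section

namespace MeasField

/-! ### Norms of arrows, bounded sections and invertibility. -/

section Basic

variable {X : Type u} [MeasurableSpace X]

@[simp]
theorem app_id (H : MeasField.{u, w} X) (x : X) :
    app (𝟙 H) x = ContinuousLinearMap.id ℂ (H.fiber x) :=
  rfl

@[simp]
theorem app_comp {H K L : MeasField.{u, w} X} (φ : H ⟶ K) (ψ : K ⟶ L) (x : X) :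
    app (φ ≫ ψ) x = (app ψ x).comp (app φ x) :=
  rfl

@[simp]
theorem app_zero (H K : MeasField.{u, w} X) (x : X) : app (0 : H ⟶ K) x = 0 :=
  rfl

@[simp]
theorem app_add {H K : MeasField.{u, w} X} (φ ψ : H ⟶ K) (x : X) :
    app (φ + ψ) x = app φ x + app ψ x :=
  rfl

@[simp]
theorem app_smul {H K : MeasField.{u, w} X} (c : ℂ) (φ : H ⟶ K) (x : X) :
    app (c • φ) x = c • app φ x :=
  rfl

theorem app_mem {H K : MeasField.{u, w} X} (φ : H ⟶ K) {ξ : ∀ x, H.fiber x}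
    (hξ : ξ ∈ H.sections) : (fun x => app φ x (ξ x)) ∈ K.sections :=
  φ.2.2 ξ hξ

theorem norm_app_le {H K : MeasField.{u, w} X} (φ : H ⟶ K) (x : X) : ‖app φ x‖ ≤ ‖φ‖ :=
  le_ciSup φ.2.1 x

theorem hom_norm_nonneg {H K : MeasField.{u, w} X} (φ : H ⟶ K) : 0 ≤ ‖φ‖ :=
  Real.iSup_nonneg fun _ => norm_nonneg _

theorem hom_norm_le {H K : MeasField.{u, w} X} (φ : H ⟶ K) {c : ℝ} (hc : 0 ≤ c)
    (h : ∀ x, ‖app φ x‖ ≤ c) : ‖φ‖ ≤ c :=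
  Real.iSup_le h hc

theorem hom_norm_comp_le {H K L : MeasField.{u, w} X} (φ : H ⟶ K) (ψ : K ⟶ L) :
    ‖φ ≫ ψ‖ ≤ ‖ψ‖ * ‖φ‖ :=
  hom_norm_le _ (mul_nonneg (hom_norm_nonneg ψ) (hom_norm_nonneg φ)) fun x =>
    (ContinuousLinearMap.opNorm_comp_le _ _).trans
      (mul_le_mul (norm_app_le ψ x) (norm_app_le φ x) (norm_nonneg _) (hom_norm_nonneg ψ))

/-- An arrow from a uniformly bounded family of operators preserving measurable sections. -/
def mkHom {H K : MeasField.{u, w} X} (φ : ∀ x, H.fiber x →L[ℂ] K.fiber x) {c : ℝ}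
    (hc : ∀ x, ‖φ x‖ ≤ c) (h : ∀ ξ ∈ H.sections, (fun x => φ x (ξ x)) ∈ K.sections) : H ⟶ K :=
  ⟨φ, ⟨c, by rintro _ ⟨x, rfl⟩; exact hc x⟩, h⟩

@[simp]
theorem app_mkHom {H K : MeasField.{u, w} X} (φ : ∀ x, H.fiber x →L[ℂ] K.fiber x) {c : ℝ}
    (hc : ∀ x, ‖φ x‖ ≤ c) (h : ∀ ξ ∈ H.sections, (fun x => φ x (ξ x)) ∈ K.sections) (x : X) :
    app (mkHom φ hc h) x = φ x :=
  rfl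

/-- The measurable sections form a module over the measurable functions. -/
theorem measurable_smul_mem {H : MeasField.{u, w} X} {g : X → ℂ} (hg : Measurable g)
    {ξ : ∀ x, H.fiber x} (hξ : ξ ∈ H.sections) : (fun x => g x • ξ x) ∈ H.sections := by
  refine H.mem_of_measurable_inner _ fun ζ hζ => ?_
  simp only [inner_smul_left]
  exact (Complex.continuous_conj.measurable.comp hg).mul (H.measurable_inner hξ hζ)

open Classical in
/-- A section vanishing outside a point is measurable. -/
theorem single_mem [MeasurableSingletonClass X] (H : MeasField.{u, w} X) (x : X)
    (v : H.fiber x) : (Pi.single x v : ∀ x, H.fiber x) ∈ H.sections := by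
  refine H.mem_of_measurable_inner _ fun ξ _ => ?_
  have e : (fun z => inner ℂ ((Pi.single x v : ∀ x, H.fiber x) z) (ξ z)) =
      fun z => if z ∈ ({x} : Set X) then inner ℂ v (ξ x) else (0 : ℂ) := by
    funext z
    by_cases h : z = x
    · subst h; simp
    · simp [h]
  rw [e]
  exact Measurable.ite (measurableSet_singleton x) measurable_const measurable_const

open Classical in
theorem norm_single_le (H : MeasField.{u, w} X) (x : X) (v : H.fiber x) (z : X) :
    ‖(Pi.single x v : ∀ x, H.fiber x) z‖ ≤ ‖v‖ := by
  by_cases h : z = x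
  · subst h; simp
  · simp [h]

/-- Every measurable section is a positive multiple of a bounded measurable section. -/
theorem exists_bounded_section {H : MeasField.{u, w} X} {ξ : ∀ x, H.fiber x}
    (hξ : ξ ∈ H.sections) : ∃ (r : X → ℝ) (ζ : ∀ x, H.fiber x), Measurable r ∧ ζ ∈ H.sections ∧
      (∀ x, ‖ζ x‖ ≤ 1) ∧ ∀ x, ξ x = (r x : ℂ) • ζ x := by
  have hn := H.measurable_norm ξ hξ
  have hp (x : X) : 0 < 1 + ‖ξ x‖ := by positivity
  -- Dividing by `1 + ‖ξ x‖` rather than `‖ξ x‖` avoids the zeros of `ξ`.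
  refine ⟨fun x => 1 + ‖ξ x‖, fun x => (((1 + ‖ξ x‖)⁻¹ : ℝ) : ℂ) • ξ x, hn.const_add 1,
    measurable_smul_mem (Complex.measurable_ofReal.comp (hn.const_add 1).inv) hξ,
    fun x => ?_, fun x => ?_⟩
  · rw [norm_smul, Complex.norm_real, Real.norm_of_nonneg (inv_nonneg.2 (hp x).le),
      inv_mul_le_one₀ (hp x)]
    linarith
  · rw [smul_smul, ← Complex.ofReal_mul, mul_inv_cancel₀ (hp x).ne']
    simp

/-- An arrow is invertible if it is uniformly bounded below and every bounded measurable section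
lifts along it. -/
theorem isIso_of_bounded_below [MeasurableSingletonClass X] {H K : MeasField.{u, w} X}
    (φ : H ⟶ K) {M : ℝ} (hM : ∀ x v, ‖v‖ ≤ M * ‖app φ x v‖)
    (hφ : ∀ ζ ∈ K.sections, ∀ c : ℝ, (∀ x, ‖ζ x‖ ≤ c) →
      ∃ ξ ∈ H.sections, ∀ x, app φ x (ξ x) = ζ x) : IsIso φ := by
  classical
  have inj (x : X) : Function.Injective (app φ x) := by
    rw [injective_iff_map_eq_zero]
    intro v hv
    simpa [hv] using hM x v
  have surj (x : X) : Function.Surjective (app φ x) := by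
    intro w
    obtain ⟨ξ, -, h⟩ := hφ _ (K.single_mem x w) _ (K.norm_single_le x w)
    exact ⟨ξ x, by simpa using h x⟩
  let e (x : X) : H.fiber x ≃ₗ[ℂ] K.fiber x :=
    LinearEquiv.ofBijective (app φ x).toLinearMap ⟨inj x, surj x⟩
  have he (x : X) (w : K.fiber x) : app φ x ((e x).symm w) = w := (e x).apply_symm_apply w
  have he' (x : X) (v : H.fiber x) : (e x).symm (app φ x v) = v := (e x).symm_apply_apply v
  -- The absolute value is needed because `M` may be negative when all fibers vanish.
  have hb (x : X) (w : K.fiber x) : ‖(e x).symm w‖ ≤ |M| * ‖w‖ := by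
    have h := hM x ((e x).symm w)
    rw [he] at h
    exact h.trans (mul_le_mul_of_nonneg_right (le_abs_self M) (norm_nonneg _))
  let ψ : K ⟶ H := mkHom (fun x => (e x).symm.toLinearMap.mkContinuous |M| (hb x)) (c := |M|)
    (fun x => LinearMap.mkContinuous_norm_le _ (abs_nonneg M) _) fun ζ hζ => by
      -- Only bounded sections are known to lift; the factor `r` is restored afterwards, and
      -- injectivity identifies the lift with the inverse image.
      obtain ⟨r, ζ', hr, hζ', hb', hrζ⟩ := exists_bounded_section hζ
      obtain ⟨ξ, hξ, h⟩ := hφ ζ' hζ' 1 hb'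
      have e1 : (fun x => (e x).symm.toLinearMap.mkContinuous |M| (hb x) (ζ x)) =
          fun x => (r x : ℂ) • ξ x := by
        funext x
        change (e x).symm (ζ x) = _
        rw [hrζ x, ← h x, map_smul, he']
      rw [e1]
      exact measurable_smul_mem (Complex.measurable_ofReal.comp hr) hξ
  refine ⟨ψ, hom_ext fun x => ?_, hom_ext fun x => ?_⟩
  · ext v
    exact he' x v
  · ext w
    exact he x w

end Basic

/-! ### Line fields, their idempotents and their categorical recognition. -/

section Frame

variable {X : Type u} [MeasurableSpace X]

/-- A measurable section of unit vectors spanning every fiber, exhibiting `L` as a field of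
one-dimensional Hilbert spaces. -/
structure UnitFrame (L : MeasField.{u, w} X) where
  /-- the unit vectors -/
  vec : ∀ x, L.fiber x
  mem : vec ∈ L.sections
  norm_vec : ∀ x, ‖vec x‖ = 1
  inner_smul_vec : ∀ x u, inner ℂ (vec x) u • vec x = u

namespace UnitFrame

variable {L : MeasField.{u, w} X} (σ : UnitFrame L)

theorem inner_self (x : X) : inner ℂ (σ.vec x) (σ.vec x) = (1 : ℂ) := by
  rw [inner_self_eq_norm_sq_to_K, σ.norm_vec]; simp

theorem vec_ne_zero (x : X) : σ.vec x ≠ 0 := by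
  rw [← norm_ne_zero_iff, σ.norm_vec]; exact one_ne_zero

include σ in
theorem ext_hom {H : MeasField.{u, w} X} {φ ψ : L ⟶ H}
    (h : ∀ x, app φ x (σ.vec x) = app ψ x (σ.vec x)) : φ = ψ := by
  refine hom_ext fun x => ?_
  ext u
  rw [← σ.inner_smul_vec x u, map_smul, map_smul, h]

/-- The arrow carrying the frame to a given bounded measurable section. -/
def ofSection {H : MeasField.{u, w} X} (ξ : ∀ x, H.fiber x) (hξ : ξ ∈ H.sections) {c : ℝ}
    (hc : ∀ x, ‖ξ x‖ ≤ c) : L ⟶ H :=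
  mkHom (fun x => (innerSL ℂ (σ.vec x)).smulRight (ξ x)) (c := c)
    (fun x => by simpa [σ.norm_vec] using hc x) fun ζ hζ => by
      simpa using measurable_smul_mem (L.measurable_inner σ.mem hζ) hξ

@[simp]
theorem ofSection_vec {H : MeasField.{u, w} X} (ξ : ∀ x, H.fiber x) (hξ : ξ ∈ H.sections) {c : ℝ}
    (hc : ∀ x, ‖ξ x‖ ≤ c) (x : X) : app (σ.ofSection ξ hξ hc) x (σ.vec x) = ξ x := by
  simp only [ofSection, app_mkHom, ContinuousLinearMap.smulRight_apply, innerSL_apply_apply,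
    σ.inner_self, one_smul]

theorem norm_app_eq {H : MeasField.{u, w} X} (φ : L ⟶ H) (x : X) :
    ‖app φ x‖ = ‖app φ x (σ.vec x)‖ := by
  apply le_antisymm
  · refine ContinuousLinearMap.opNorm_le_bound _ (norm_nonneg _) fun u => ?_
    conv_lhs => rw [← σ.inner_smul_vec x u, map_smul, norm_smul, mul_comm]
    refine mul_le_mul_of_nonneg_left ?_ (norm_nonneg _)
    simpa [σ.norm_vec] using norm_inner_le_norm (𝕜 := ℂ) (σ.vec x) u
  · simpa [σ.norm_vec] using (app φ x).le_opNorm (σ.vec x)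

open Classical in
/-- The arrow with value `v` on the frame at the point `x`, vanishing elsewhere. -/
def single [MeasurableSingletonClass X] {H : MeasField.{u, w} X} (x : X) (v : H.fiber x) :
    L ⟶ H :=
  σ.ofSection (Pi.single x v) (H.single_mem x v) (H.norm_single_le x v)

section Single

variable [MeasurableSingletonClass X] {H K : MeasField.{u, w} X}

@[simp]
theorem single_vec_self (x : X) (v : H.fiber x) : app (σ.single x v) x (σ.vec x) = v := by
  simp [single]

theorem single_vec_of_ne {x z : X} (h : z ≠ x) (v : H.fiber x) :
    app (σ.single x v) z (σ.vec z) = 0 := by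
  simp [single, h]

/-- Being isometric, `single` turns norm bounds on a functor into norm bounds in the fibers. -/
theorem norm_single (x : X) (v : H.fiber x) : ‖σ.single x v‖ = ‖v‖ := by
  apply le_antisymm
  · refine hom_norm_le _ (norm_nonneg _) fun z => ?_
    rw [norm_app_eq σ, single, ofSection_vec]
    exact H.norm_single_le x v z
  · simpa [norm_app_eq σ] using norm_app_le (σ.single x v) x

theorem single_add (x : X) (v w : H.fiber x) :
    σ.single x (v + w) = σ.single x v + σ.single x w := by
  refine σ.ext_hom fun z => ?_
  by_cases h : z = x
  · subst h; simp
  · simp [single_vec_of_ne, h]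

theorem single_smul (x : X) (c : ℂ) (v : H.fiber x) :
    σ.single x (c • v) = c • σ.single x v := by
  refine σ.ext_hom fun z => ?_
  by_cases h : z = x
  · subst h; simp
  · simp [single_vec_of_ne, h]

theorem single_comp (x : X) (v : H.fiber x) (φ : H ⟶ K) :
    σ.single x v ≫ φ = σ.single x (app φ x v) := by
  refine σ.ext_hom fun z => ?_
  by_cases h : z = x
  · subst h; simp
  · simp [single_vec_of_ne, h]

end Single

/-- The projection of a line field onto its restriction to a measurable set. -/
def proj (A : Set X) (hA : MeasurableSet A) : L ⟶ L :=
  σ.ofSection (fun x => (A.indicator 1 x : ℂ) • σ.vec x)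
    (measurable_smul_mem (measurable_one.indicator hA) σ.mem) (c := 1) fun x => by
      by_cases h : x ∈ A <;> simp [h, σ.norm_vec]

theorem proj_vec_of_mem {A : Set X} (hA : MeasurableSet A) {x : X} (h : x ∈ A) :
    app (σ.proj A hA) x (σ.vec x) = σ.vec x := by
  simp [proj, h]

theorem proj_vec_of_notMem {A : Set X} (hA : MeasurableSet A) {x : X} (h : x ∉ A) :
    app (σ.proj A hA) x (σ.vec x) = 0 := by
  simp [proj, h]

/-- With `proj_eq_zero_iff`, this makes disjointness of measurable sets visible to any faithful
functor preserving zero. -/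
theorem proj_comp_proj {A B : Set X} (hA : MeasurableSet A) (hB : MeasurableSet B) :
    σ.proj A hA ≫ σ.proj B hB = σ.proj (A ∩ B) (hA.inter hB) := by
  refine σ.ext_hom fun x => ?_
  by_cases ha : x ∈ A <;> by_cases hb : x ∈ B <;>
    simp [proj, ha, hb]

theorem proj_eq_zero_iff {A : Set X} (hA : MeasurableSet A) : σ.proj A hA = 0 ↔ A = ∅ := by
  refine ⟨fun h => Set.eq_empty_of_forall_notMem fun x hx => σ.vec_ne_zero x ?_, ?_⟩
  · rw [← σ.proj_vec_of_mem hA hx, h]; simp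
  · rintro rfl
    exact σ.ext_hom fun x => by simp [σ.proj_vec_of_notMem]

theorem eq_of_proj_eq {A B : Set X} {hA : MeasurableSet A} {hB : MeasurableSet B}
    (h : σ.proj A hA = σ.proj B hB) : A = B := by
  ext x
  by_cases ha : x ∈ A <;> by_cases hb : x ∈ B <;> simp only [ha, hb]
  · have := σ.proj_vec_of_mem hA ha
    rw [h, σ.proj_vec_of_notMem hB hb] at this
    exact (σ.vec_ne_zero x this.symm).elim
  · have := σ.proj_vec_of_mem hB hb
    rw [← h, σ.proj_vec_of_notMem hA ha] at this
    exact (σ.vec_ne_zero x this.symm).elim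

/-- Every idempotent endomorphism of a line field is a projection onto a restriction. -/
theorem exists_eq_proj (e : L ⟶ L) (he : e ≫ e = e) : ∃ A hA, e = σ.proj A hA := by
  -- An endomorphism is multiplication by a measurable function `g`; idempotency gives `g * g = g`,
  -- so `g` is an indicator function.
  let g (x : X) : ℂ := inner ℂ (σ.vec x) (app e x (σ.vec x))
  have hg : Measurable g := L.measurable_inner σ.mem (app_mem e σ.mem)
  have hge (x : X) : app e x (σ.vec x) = g x • σ.vec x := (σ.inner_smul_vec x _).symm
  have hgg (x : X) : g x * g x = g x := by
    have h : app (e ≫ e) x (σ.vec x) = app e x (σ.vec x) := by rw [he]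
    simp only [app_comp, ContinuousLinearMap.comp_apply, hge, map_smul, smul_smul] at h
    exact smul_left_injective ℂ (σ.vec_ne_zero x) h
  have hA : MeasurableSet (g ⁻¹' {1}) := hg (measurableSet_singleton 1)
  refine ⟨g ⁻¹' {1}, hA, σ.ext_hom fun x => ?_⟩
  rw [hge]
  by_cases h : g x = 1
  · rw [σ.proj_vec_of_mem hA h, h, one_smul]
  · rw [σ.proj_vec_of_notMem hA h]
    have h0 : g x = 0 := by
      by_contra h0
      exact h (mul_left_cancel₀ h0 (by rw [hgg, mul_one]))
    rw [h0, zero_smul]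

-- Operators on a one-dimensional fiber are scalars.
include σ in
theorem end_comm (φ ψ : L ⟶ L) : φ ≫ ψ = ψ ≫ φ := by
  refine σ.ext_hom fun x => ?_
  simp only [app_comp, ContinuousLinearMap.comp_apply]
  rw [← σ.inner_smul_vec x (app φ x (σ.vec x)), ← σ.inner_smul_vec x (app ψ x (σ.vec x))]
  simp only [map_smul]
  conv_lhs => rw [← σ.inner_smul_vec x (app ψ x (σ.vec x))]
  conv_rhs => rw [← σ.inner_smul_vec x (app φ x (σ.vec x))]
  exact smul_comm _ _ _

/-- Being supported at `x` is thus expressed by composition with an idempotent, a condition that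
functors transport. -/
theorem proj_singleton_comp_single [MeasurableSingletonClass X] {H : MeasField.{u, w} X} (x : X)
    (φ : L ⟶ H) : σ.proj {x} (measurableSet_singleton x) ≫ φ =
      σ.single x (app φ x (σ.vec x)) := by
  refine σ.ext_hom fun z => ?_
  by_cases h : z = x
  · subst h; simp [proj_vec_of_mem]
  · simp [single_vec_of_ne, h, proj_vec_of_notMem]

include σ in
/-- A line field is a separator. -/
theorem isSeparator [MeasurableSingletonClass X] : IsSeparator L := by
  rw [isSeparator_def]
  intro H K φ ψ h
  refine hom_ext fun x => ?_
  ext v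
  have := congrArg (fun χ => app χ x (σ.vec x)) (h (σ.single x v))
  simpa using this

end UnitFrame

/-- A field of Hilbert spaces whose fibers are all one-dimensional has a unit frame. -/
theorem nonempty_unitFrame (L : MeasField.{u, w} X) (h0 : ∀ x, ∃ v : L.fiber x, v ≠ 0)
    (h1 : ∀ x (u v : L.fiber x), u ≠ 0 → ∃ c : ℂ, v = c • u) : Nonempty (UnitFrame L) := by
  classical
  obtain ⟨ξ, hξ, hd⟩ := L.exists_fundamental_sequence
  have hex (x : X) : ∃ i, ‖ξ i x‖ ≠ 0 := by
    by_contra! h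
    obtain ⟨v, hv⟩ := h0 x
    have hs : Set.range (fun i => ξ i x) ⊆ {0} := by
      rintro _ ⟨i, rfl⟩
      simpa using h i
    have := (hd x).closure_eq ▸ closure_minimal hs isClosed_singleton
    exact hv (this (Set.mem_univ v))
  -- The first index with a nonzero vector depends measurably on `x`, and the index set is
  -- countable, so the selected section is measurable.
  let n (x : X) : ℕ := Nat.find (hex x)
  have hn : Measurable n := measurable_find _ fun i =>
    (L.measurable_norm _ (hξ i)) (measurableSet_singleton 0).compl
  have hnx (x : X) : ‖ξ (n x) x‖ ≠ 0 := Nat.find_spec (hex x)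
  have hη : (fun x => ξ (n x) x) ∈ L.sections := by
    refine L.mem_of_measurable_inner _ fun ζ hζ => ?_
    have : Measurable fun p : ℕ × X => (inner ℂ (ξ p.1 p.2) (ζ p.2) : ℂ) :=
      measurable_from_prod_countable_right fun i => L.measurable_inner (hξ i) hζ
    exact this.comp (hn.prodMk measurable_id)
  have hm := L.measurable_norm _ hη
  have hσ (x : X) : ‖((‖ξ (n x) x‖⁻¹ : ℝ) : ℂ) • ξ (n x) x‖ = 1 := by
    rw [norm_smul, Complex.norm_real, norm_inv, norm_norm, inv_mul_cancel₀ (hnx x)]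
  refine ⟨⟨fun x => ((‖ξ (n x) x‖⁻¹ : ℝ) : ℂ) • ξ (n x) x,
    measurable_smul_mem (Complex.measurable_ofReal.comp hm.inv) hη, hσ, fun x u => ?_⟩⟩
  have hne : ((‖ξ (n x) x‖⁻¹ : ℝ) : ℂ) • ξ (n x) x ≠ 0 := by
    rw [← norm_ne_zero_iff, hσ]; exact one_ne_zero
  obtain ⟨c, hc⟩ := h1 x _ u hne
  conv_lhs => rw [hc, inner_smul_right, inner_self_eq_norm_sq_to_K, hσ]
  rw [hc]
  simp

/-- If the endomorphisms of a field commute, its fibers are at most one-dimensional. -/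
theorem exists_smul_eq_of_end_comm [MeasurableSingletonClass X] (L : MeasField.{u, w} X)
    (hL : ∀ φ ψ : L ⟶ L, φ ≫ ψ = ψ ≫ φ) (x : X) (u v : L.fiber x) (hu : u ≠ 0) :
    ∃ c : ℂ, v = c • u := by
  classical
  -- Comparing the rank-one operators `z ↦ ⟨u, z⟩ u` and `z ↦ ⟨u, z⟩ v` in both orders at `u` yields
  -- `⟨u, u⟩ v = ⟨u, v⟩ u`.
  have key (w : L.fiber x) : ∃ φ : L ⟶ L, ∀ z, app φ x z = (inner ℂ u z : ℂ) • w :=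
    ⟨mkHom (fun z => (innerSL ℂ ((Pi.single x u : ∀ x, L.fiber x) z)).smulRight
        ((Pi.single x w : ∀ x, L.fiber x) z)) (c := ‖u‖ * ‖w‖)
      (fun z => by
        simpa using mul_le_mul (L.norm_single_le x u z) (L.norm_single_le x w z)
          (norm_nonneg _) (norm_nonneg _))
      (fun ζ hζ => by
        simpa using measurable_smul_mem (L.measurable_inner (L.single_mem x u) hζ)
          (L.single_mem x w)), fun z => by simp⟩
  obtain ⟨a, ha⟩ := key u
  obtain ⟨b, hb⟩ := key v
  have h : app (a ≫ b) x u = app (b ≫ a) x u := by rw [hL]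
  simp only [app_comp, ContinuousLinearMap.comp_apply, ha, hb, inner_smul_right, mul_smul] at h
  have hne : (inner ℂ u u : ℂ) ≠ 0 := inner_self_ne_zero.2 hu
  refine ⟨(inner ℂ u u : ℂ)⁻¹ * inner ℂ u v, ?_⟩
  have h' := smul_right_injective _ hne h
  rw [mul_smul, ← h', smul_smul, inv_mul_cancel₀ hne, one_smul]

/-- The field with all fibers equal to a fixed one-dimensional space. -/
def trivialLine (X : Type u) [MeasurableSpace X] : MeasField.{u, w} X where
  -- A copy of `ℂ` in the universe `w` of the fibers.
  fiber _ := EuclideanSpace ℂ PUnit.{w + 1}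
  sections :=
    { carrier := {ξ | Measurable fun x => ξ x PUnit.unit}
      zero_mem' := measurable_const
      add_mem' := fun ha hb => Measurable.add ha hb
      smul_mem' := fun c _ ha => Measurable.const_mul ha c }
  measurable_norm ξ hξ := by
    have h : Measurable fun x => ξ x PUnit.unit := hξ
    simpa [EuclideanSpace.norm_eq] using h.norm
  mem_of_measurable_inner η h := by
    have h' := h (fun _ => EuclideanSpace.single PUnit.unit 1) measurable_const
    have h'' := Complex.continuous_conj.measurable.comp h'
    change Measurable fun x => η x PUnit.unit
    simpa [Function.comp_def, EuclideanSpace.inner_single_right] using h''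
  exists_fundamental_sequence := by
    refine ⟨fun i _ => TopologicalSpace.denseSeq _ i, fun i => measurable_const, fun x =>
      TopologicalSpace.denseRange_denseSeq _⟩

/-- The constant unit section of the trivial line field. -/
def trivialFrame (X : Type u) [MeasurableSpace X] : UnitFrame (trivialLine.{u, w} X) where
  vec _ := EuclideanSpace.single PUnit.unit (1 : ℂ)
  mem := measurable_const
  norm_vec x := by
    change ‖(EuclideanSpace.single PUnit.unit (1 : ℂ) : EuclideanSpace ℂ PUnit.{w + 1})‖ = 1
    simp
  inner_smul_vec x u := by
    have h (z : EuclideanSpace ℂ PUnit.{w + 1}) :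
        (inner ℂ (EuclideanSpace.single PUnit.unit (1 : ℂ)) z : ℂ) •
          EuclideanSpace.single PUnit.unit (1 : ℂ) = z := by
      ext i
      simp [EuclideanSpace.inner_single_left]
    exact h u

end Frame

/-! ### Pullback along an isomorphism of measurable spaces. -/

section PullbackIso

variable {X : Type u} {Y : Type v} [MeasurableSpace X] [MeasurableSpace Y]

/-- The measurable sections of the pullback along an isomorphism are the pullbacks of the
measurable sections. -/
theorem mem_pullbackObj_sections_iff (f : Y ≃ᵐ X) {H : MeasField.{u, w} X}
    {η : ∀ y, H.fiber (f y)} : η ∈ (pullbackObj f f.measurable H).sections ↔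
      ∃ ξ ∈ H.sections, ∀ y, η y = ξ (f y) := by
  constructor
  · intro hη
    let ξ : ∀ x, H.fiber x := fun x => f.apply_symm_apply x ▸ η (f.symm x)
    have hξ (y : Y) : ξ (f y) = η y := by
      -- Generalizing `f.symm (f y)` to `z` allows the cast to be eliminated by substitution.
      have : ∀ z (h : z = y), (congrArg f h : f z = f y) ▸ η z = η y := by
        rintro z rfl; rfl
      exact this (f.symm (f y)) (f.symm_apply_apply y)
    refine ⟨ξ, H.mem_of_measurable_inner _ fun ζ hζ => ?_, fun y => (hξ y).symm⟩
    rw [← f.measurable_comp_iff]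
    have h := Complex.continuous_conj.measurable.comp (hη ζ hζ)
    simpa only [Function.comp_def, inner_conj_symm, hξ] using h
  · rintro ⟨ξ, hξ, h⟩ ζ hζ
    simp only [h]
    exact (H.measurable_inner hζ hξ).comp f.measurable

/-- The identification of the fibers of a field at equal points. -/
def transport (H : MeasField.{u, w} X) {x x' : X} (h : x = x') :
    H.fiber x →L[ℂ] H.fiber x' :=
  h ▸ ContinuousLinearMap.id ℂ (H.fiber x)

theorem norm_transport_le (H : MeasField.{u, w} X) {x x' : X} (h : x = x') :
    ‖H.transport h‖ ≤ 1 := by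
  subst h
  exact ContinuousLinearMap.norm_id_le

@[simp]
theorem transport_section (H : MeasField.{u, w} X) {x x' : X} (h : x = x') (ξ : ∀ x, H.fiber x) :
    H.transport h (ξ x) = ξ x' := by
  subst h
  rfl

theorem transport_transport (H : MeasField.{u, w} X) {x x' : X} (h : x = x') (h' : x' = x)
    (v : H.fiber x) : H.transport h' (H.transport h v) = v := by
  subst h
  rfl

theorem transport_app {H K : MeasField.{u, w} X} (φ : H ⟶ K) {x x' : X} (h : x = x')
    (v : H.fiber x) : K.transport h (app φ x v) = app φ x' (H.transport h v) := by
  subst h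
  rfl

/-- Pulling back along the inverse and then along an isomorphism is isomorphic to the identity. -/
def pullbackSymmCompPullbackIso (f : Y ≃ᵐ X) :
    pullback.{v, u, w} f.symm f.symm.measurable ⋙ pullback f f.measurable ≅
      𝟭 (MeasField.{v, w} Y) :=
  NatIso.ofComponents (fun H =>
    { hom := mkHom (H := pullbackObj f f.measurable (pullbackObj f.symm f.symm.measurable H))
        (fun y => H.transport (f.symm_apply_apply y)) (fun y => H.norm_transport_le _) fun η hη => by
          obtain ⟨ξ, hξ, h⟩ := (mem_pullbackObj_sections_iff f).1 hη
          obtain ⟨ζ, hζ, h'⟩ := (mem_pullbackObj_sections_iff f.symm).1 hξ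
          refine (congrArg (· ∈ H.sections) (funext fun y => ?_)).mp hζ
          rw [h y, h' (f y)]
          exact (H.transport_section _ ζ).symm
      inv := mkHom (K := pullbackObj f f.measurable (pullbackObj f.symm f.symm.measurable H))
        (fun y => H.transport (f.symm_apply_apply y).symm) (fun y => H.norm_transport_le _)
        fun ζ hζ => (mem_pullbackObj_sections_iff f).2 ⟨fun x => ζ (f.symm x),
          (mem_pullbackObj_sections_iff f.symm).2 ⟨ζ, hζ, fun _ => rfl⟩, fun y =>
            H.transport_section _ ζ⟩
      hom_inv_id := hom_ext fun y => ContinuousLinearMap.ext fun v => H.transport_transport _ _ v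
      inv_hom_id := hom_ext fun y => ContinuousLinearMap.ext fun v => H.transport_transport _ _ v })
    fun φ => hom_ext fun y => ContinuousLinearMap.ext fun v => (transport_app φ _ v)

end PullbackIso

/-! ### Recovering the point map and the fibers from an equivalence. -/

section Equivalence

variable {X : Type u} {Y : Type v} [MeasurableSpace X] [MeasurableSpace Y]
  [MeasurableSingletonClass X]

/-- An equivalence carries line fields to line fields. -/
theorem nonempty_unitFrame_map [MeasurableSingletonClass Y]
    (F : MeasField.{u, w} X ⥤ MeasField.{v, w} Y) [F.IsEquivalence]
    {L : MeasField.{u, w} X} (σ : UnitFrame L) : Nonempty (UnitFrame (F.obj L)) := by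
  refine nonempty_unitFrame _ (fun y => ?_) (exists_smul_eq_of_end_comm _ fun φ ψ => ?_)
  · by_contra! h0
    have hs : IsSeparator (F.obj L) := σ.isSeparator.of_equivalence F.asEquivalence
    -- If the fiber at `y` were zero, every arrow from `F.obj L` would vanish there and could not
    -- tell the projection at `y` from zero.
    rw [isSeparator_def] at hs
    have hp := hs ((trivialFrame Y).proj {y} (measurableSet_singleton y)) 0 fun χ => by
      refine hom_ext fun z => ?_
      ext v
      rw [app_comp, ContinuousLinearMap.comp_apply,
        ← (trivialFrame Y).inner_smul_vec z (app χ z v), map_smul]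
      by_cases hz : z = y
      · subst hz
        rw [h0 v]
        simp
      · rw [UnitFrame.proj_vec_of_notMem _ _ (by simpa using hz)]
        simp
    rw [UnitFrame.proj_eq_zero_iff] at hp
    exact Set.singleton_ne_empty y hp
  · obtain ⟨φ, rfl⟩ := F.map_surjective φ
    obtain ⟨ψ, rfl⟩ := F.map_surjective ψ
    rw [← F.map_comp, ← F.map_comp, σ.end_comm]

/-- A fully faithful functor relating two line fields relates the projections onto their
restrictions to points by an isomorphism of measurable spaces. -/
theorem exists_measurableEquiv [MeasurableSingletonClass Y]
    (F : MeasField.{u, w} X ⥤ MeasField.{v, w} Y)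
    [F.PreservesZeroMorphisms] [F.Full] [F.Faithful] {L : MeasField.{u, w} X} (σ : UnitFrame L)
    (τ : UnitFrame (F.obj L)) : ∃ f : Y ≃ᵐ X, ∀ y,
      F.map (σ.proj {f y} (measurableSet_singleton _)) =
        τ.proj {y} (measurableSet_singleton y) := by
  have img {A : Set X} (hA : MeasurableSet A) : ∃ B hB, F.map (σ.proj A hA) = τ.proj B hB :=
    τ.exists_eq_proj _ (by rw [← F.map_comp, σ.proj_comp_proj]; simp only [Set.inter_self])
  have preimg {B : Set Y} (hB : MeasurableSet B) :
      ∃ A hA, F.map (σ.proj A hA) = τ.proj B hB := by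
    obtain ⟨e, he⟩ := F.map_surjective (τ.proj B hB)
    obtain ⟨A, hA, rfl⟩ := σ.exists_eq_proj e (F.map_injective (by
      rw [F.map_comp, he, τ.proj_comp_proj]; simp only [Set.inter_self]))
    exact ⟨A, hA, he⟩
  have inter {A A' : Set X} {B B' : Set Y} {hA : MeasurableSet A} {hA' : MeasurableSet A'}
      {hB : MeasurableSet B} {hB' : MeasurableSet B'} (h : F.map (σ.proj A hA) = τ.proj B hB)
      (h' : F.map (σ.proj A' hA') = τ.proj B' hB') :
      (A ∩ A').Nonempty ↔ (B ∩ B').Nonempty := by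
    rw [Set.nonempty_iff_ne_empty, Set.nonempty_iff_ne_empty, Ne, Ne,
      ← σ.proj_eq_zero_iff (hA.inter hA'), ← τ.proj_eq_zero_iff (hB.inter hB'),
      ← σ.proj_comp_proj hA hA', ← τ.proj_comp_proj hB hB', ← h, ← h', ← F.map_comp,
      F.map_eq_zero_iff]
  have nonempty {A : Set X} {B : Set Y} {hA : MeasurableSet A}
      {hB : MeasurableSet B} (h : F.map (σ.proj A hA) = τ.proj B hB) :
      A.Nonempty ↔ B.Nonempty := by
    simpa using inter h h
  have hex (y : Y) : ∃ x, F.map (σ.proj {x} (measurableSet_singleton x)) =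
      τ.proj {y} (measurableSet_singleton y) := by
    -- Let `A` correspond to `{y}`, pick `x ∈ A`, and let `B` correspond to `{x}`. Then `y ∈ B` as
    -- `{x}` meets `A`, and `B ⊆ {y}` as `{x} ⊆ A`.
    obtain ⟨A, hA, h⟩ := preimg (measurableSet_singleton y)
    obtain ⟨x, hx⟩ := (nonempty h).2 (Set.singleton_nonempty y)
    obtain ⟨B, hB, h'⟩ := img (measurableSet_singleton x)
    have hyB : y ∈ B := by simpa using (inter h' h).1 ⟨x, rfl, hx⟩
    refine ⟨x, ?_⟩
    have hc : σ.proj {x} (measurableSet_singleton x) ≫ σ.proj A hA =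
        σ.proj {x} (measurableSet_singleton x) := by
      rw [σ.proj_comp_proj]
      congr 1
      simpa using hx
    have hc' := congrArg F.map hc
    rw [F.map_comp, h, h', τ.proj_comp_proj] at hc'
    rw [h']
    congr 1
    rw [← τ.eq_of_proj_eq hc']
    simpa using hyB
  choose f hf using hex
  -- Matched sets satisfy `f ⁻¹' A = B`; bijectivity and both measurabilities of `f` follow from
  -- this.
  have mem_iff {A : Set X} {B : Set Y} {hA : MeasurableSet A} {hB : MeasurableSet B}
      (h : F.map (σ.proj A hA) = τ.proj B hB) (y : Y) : f y ∈ A ↔ y ∈ B := by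
    simpa using inter (hf y) h
  have finj : Function.Injective f := fun y y' h => by
    simpa [h, eq_comm] using (mem_iff (hf y') y).1 (by simp [h])
  have fsurj : Function.Surjective f := fun x => by
    obtain ⟨B, hB, h⟩ := img (measurableSet_singleton x)
    obtain ⟨y, hy⟩ := (nonempty h).1 (Set.singleton_nonempty x)
    exact ⟨y, (mem_iff h y).2 hy⟩
  let e := Equiv.ofBijective f ⟨finj, fsurj⟩
  refine ⟨⟨e, fun A hA => ?_, fun B hB => ?_⟩, hf⟩
  · obtain ⟨B, hB, h⟩ := img hA
    rwa [show e ⁻¹' A = B from Set.ext (mem_iff h)]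
  · obtain ⟨A, hA, h⟩ := preimg hB
    have : e.symm ⁻¹' B = A := by
      ext x
      obtain ⟨y, rfl⟩ := fsurj x
      rw [mem_iff h y, Set.mem_preimage, show f y = e y from rfl, e.symm_apply_apply]
    exact this ▸ hA

variable (F : MeasField.{u, w} X ⥤ MeasField.{v, w} Y) [F.Additive] [F.Linear ℂ]
  {L : MeasField.{u, w} X} (σ : UnitFrame L) (τ : UnitFrame (F.obj L))

/-- The value at a vector `v` in the fiber over `x` of the operator from the fiber of `H` at `x`
to the fiber of `F.obj H` at `y`: the image of the frame under the functor applied to the arrow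
with value `v` at `x`. -/
def fiberMap (H : MeasField.{u, w} X) (x : X) (y : Y) : H.fiber x →ₗ[ℂ] (F.obj H).fiber y where
  toFun v := app (F.map (σ.single x v)) y (τ.vec y)
  map_add' v w := by simp [σ.single_add, F.map_add]
  map_smul' c v := by simp [σ.single_smul, F.map_smul]

theorem norm_fiberMap_le {N : ℝ} (hN : ∀ (H K : MeasField.{u, w} X) (φ : H ⟶ K),
    ‖F.map φ‖ ≤ N * ‖φ‖) (H : MeasField.{u, w} X) (x : X) (y : Y) (v : H.fiber x) :
    ‖fiberMap F σ τ H x y v‖ ≤ N * ‖v‖ := by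
  have h := (app (F.map (σ.single x v)) y).le_opNorm (τ.vec y)
  rw [τ.norm_vec, mul_one] at h
  exact h.trans ((norm_app_le _ y).trans ((hN _ _ _).trans (by rw [σ.norm_single])))

theorem fiberMap_naturality {H K : MeasField.{u, w} X} (φ : H ⟶ K) (x : X) (y : Y)
    (v : H.fiber x) :
    fiberMap F σ τ K x y (app φ x v) = app (F.map φ) y (fiberMap F σ τ H x y v) := by
  change app (F.map (σ.single x (app φ x v))) y (τ.vec y) =
    app (F.map φ) y (app (F.map (σ.single x v)) y (τ.vec y))
  rw [← σ.single_comp, F.map_comp, app_comp]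
  rfl

variable [MeasurableSingletonClass Y] {f : Y ≃ᵐ X}
  (hf : ∀ y, F.map (σ.proj {f y} (measurableSet_singleton _)) =
    τ.proj {y} (measurableSet_singleton y))

include hf

/-- Composition with the projection at `f y` fixes the arrow, so its image is fixed by the
projection at `y` and determined by its value there. -/
theorem map_single (H : MeasField.{u, w} X) (y : Y) (v : H.fiber (f y)) :
    F.map (σ.single (f y) v) = τ.single y (fiberMap F σ τ H (f y) y v) := by
  have h := σ.proj_singleton_comp_single (f y) (σ.single (f y) v)
  rw [σ.single_vec_self] at h
  have h' := congrArg F.map h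
  rw [F.map_comp, hf, τ.proj_singleton_comp_single] at h'
  exact h'.symm

/-- Cutting `φ` down to the point `f y` does not change `F.map φ` at `y`. Hence the fiber maps send
a bounded section, viewed as an arrow from `L`, to its image under `F`. -/
theorem fiberMap_app {H : MeasField.{u, w} X} (φ : L ⟶ H) (y : Y) :
    fiberMap F σ τ H (f y) y (app φ (f y) (σ.vec (f y))) = app (F.map φ) y (τ.vec y) := by
  change app (F.map (σ.single _ _)) y (τ.vec y) = _
  rw [← σ.proj_singleton_comp_single, F.map_comp, hf, app_comp, ContinuousLinearMap.comp_apply,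
    τ.proj_vec_of_mem _ (Set.mem_singleton y)]

/-- The comparison arrow from the pullback of `H` to the image of `H`. -/
def comparison {N : ℝ} (hN0 : 0 ≤ N) (hN : ∀ (H K : MeasField.{u, w} X) (φ : H ⟶ K),
    ‖F.map φ‖ ≤ N * ‖φ‖) (H : MeasField.{u, w} X) :
    (pullback f f.measurable).obj H ⟶ F.obj H :=
  mkHom (H := pullbackObj f f.measurable H) (c := N)
    (fun y => (fiberMap F σ τ H (f y) y).mkContinuous N (norm_fiberMap_le F σ τ hN H _ _))
    (fun y => LinearMap.mkContinuous_norm_le _ hN0 _)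
    (fun η hη => by
      obtain ⟨ξ, hξ, h⟩ := (mem_pullbackObj_sections_iff f).1 hη
      obtain ⟨r, ζ, hr, hζ, hb, hrζ⟩ := exists_bounded_section hξ
      have hm := measurable_smul_mem
        (Complex.measurable_ofReal.comp (hr.comp f.measurable))
        (app_mem (F.map (σ.ofSection ζ hζ hb)) τ.mem)
      refine (congrArg (· ∈ (F.obj H).sections) (funext fun y => ?_)).mp hm
      have h1 := fiberMap_app F σ τ hf (σ.ofSection ζ hζ hb) y
      rw [σ.ofSection_vec] at h1
      change (r (f y) : ℂ) • app (F.map (σ.ofSection ζ hζ hb)) y (τ.vec y) =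
        fiberMap F σ τ H (f y) y (η y)
      rw [h y, hrζ (f y), map_smul, h1])

/-- The functor is isomorphic to the pullback functor. -/
theorem nonempty_iso_pullback [F.Full] (G : MeasField.{v, w} Y ⥤ MeasField.{u, w} X)
    (α : F ⋙ G ≅ 𝟭 _) (hF : IsBounded F) (hG : IsBounded G) :
    Nonempty (F ≅ pullback f f.measurable) := by
  obtain ⟨N, hN0, hN⟩ := hF
  obtain ⟨N', hN0', hN'⟩ := hG
  have below (H : MeasField.{u, w} X) (y : Y) (v : H.fiber (f y)) :
      ‖v‖ ≤ (‖α.hom.app H‖ * (N' * ‖α.inv.app L‖)) * ‖fiberMap F σ τ H (f y) y v‖ := by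
    -- Naturality of `α` recovers the arrow from its image under `F ⋙ G`. The resulting constant
    -- depends on `H` but not on `y`, which suffices for inverting each component.
    have e : σ.single (f y) v =
        α.inv.app L ≫ G.map (F.map (σ.single (f y) v)) ≫ α.hom.app H := by
      have := α.inv.naturality_assoc (σ.single (f y) v) (α.hom.app H)
      simp only [Iso.inv_hom_id_app] at this
      simpa using this
    rw [← σ.norm_single (f y) v]
    conv_lhs => rw [e]
    rw [← τ.norm_single y, ← map_single F σ τ hf]
    refine (hom_norm_comp_le _ _).trans ?_
    refine (mul_le_mul_of_nonneg_right (hom_norm_comp_le _ _) (hom_norm_nonneg _)).trans ?_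
    have h1 := mul_le_mul_of_nonneg_right (mul_le_mul_of_nonneg_left
      (hN' _ _ (F.map (σ.single (f y) v))) (hom_norm_nonneg (α.hom.app H)))
      (hom_norm_nonneg (α.inv.app L))
    refine h1.trans (le_of_eq ?_)
    ring
  have hiso (H : MeasField.{u, w} X) : IsIso (comparison F σ τ hf hN0.le hN H) := by
    refine isIso_of_bounded_below _ (below H) fun ζ hζ c hc => ?_
    -- The bounded section `ζ` is an arrow from `F.obj L`; by fullness it comes from an arrow `φ`,
    -- that is, from a section of `H`.
    obtain ⟨φ, hφ⟩ := F.map_surjective (τ.ofSection ζ hζ hc)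
    refine ⟨fun y => app φ (f y) (σ.vec (f y)),
      (mem_pullbackObj_sections_iff f).2 ⟨_, app_mem φ σ.mem, fun _ => rfl⟩, fun y => ?_⟩
    change fiberMap F σ τ H (f y) y _ = _
    rw [fiberMap_app F σ τ hf, hφ, τ.ofSection_vec]
  exact ⟨(NatIso.ofComponents (fun H => @asIso _ _ _ _ (comparison F σ τ hf hN0.le hN H) (hiso H))
    fun {H K} φ => hom_ext fun y => by
      ext v
      exact fiberMap_naturality F σ τ φ (f y) y v).symm⟩

end Equivalence

end MeasField

end

theorem theorem23 {X : Type u} {Y : Type v} [MeasurableSpace X] [MeasurableSpace Y]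
    [MeasurableSingletonClass X] [MeasurableSingletonClass Y]
    (F : MeasField.{u, w} X ⥤ MeasField.{v, w} Y) (G : MeasField.{v, w} Y ⥤ MeasField.{u, w} X)
    [F.Additive] [F.Linear ℂ]
    (hFG : Nonempty (F ⋙ G ≅ 𝟭 (MeasField.{u, w} X)))
    (hGF : Nonempty (G ⋙ F ≅ 𝟭 (MeasField.{v, w} Y)))
    (hF : MeasField.IsBounded F) (hG : MeasField.IsBounded G) :
    ∃ f : Y ≃ᵐ X,
      Nonempty (F ≅ MeasField.pullback f f.measurable) ∧
      Nonempty (G ≅ MeasField.pullback f.symm f.symm.measurable) := by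
  obtain ⟨α⟩ := hFG
  obtain ⟨β⟩ := hGF
  have : F.IsEquivalence := (CategoryTheory.Equivalence.mk F G α.symm β).isEquivalence_functor
  let σ := MeasField.trivialFrame.{u, w} X
  obtain ⟨τ⟩ := MeasField.nonempty_unitFrame_map F σ
  obtain ⟨f, hf⟩ := MeasField.exists_measurableEquiv F σ τ
  obtain ⟨γ⟩ := MeasField.nonempty_iso_pullback F σ τ hf G α hF hG
  refine ⟨f, ⟨γ⟩, ⟨?_⟩⟩
  let P := MeasField.pullback.{v, u, w} f.symm f.symm.measurable
  let ε := MeasField.pullbackSymmCompPullbackIso.{u, v, w} f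
  -- With `P` the pullback along `f.symm`, `P ⋙ F` is isomorphic to the identity, so `G ≅ (P ⋙ F) ⋙
  -- G ≅ P ⋙ (F ⋙ G) ≅ P`.
  exact (Functor.leftUnitor G).symm ≪≫
    Functor.isoWhiskerRight (ε.symm ≪≫ Functor.isoWhiskerLeft P γ.symm) G ≪≫ Functor.associator P F G ≪≫
    Functor.isoWhiskerLeft P α ≪≫ Functor.rightUnitor P
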